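/- Let $A$ be an annulus. A graph $G$ in $A$ consists of finitely many vertices in the interior of $A$ and finitely many arcs (edges) with pairwise disjoint interiors, each end of an edge lying at a vertex or on $\partial A$, and at least one end of each edge lying at a vertex. Distinct edges end at distinct points of $\partial A$, and points of $\partial A$ do not count as vertices; loops and multiple edges are allowed, and $G$ need not be connected. An edge is a boundary edge if it has an end on $\partial A$. A vertex is a boundary vertex if it is incident to a boundary edge, and an interior vertex otherwise. The valency of a vertex is the number of ends of edges at it. The number of edges of a face that is a disk is the number of sides of edges of $G$ on its boundary: an edge with this face on both sides counts twice, and segments of $\partial A$ do not count. A monogon or bigon is a face that is a disk with one, respectively two, edges. Edges are parallel if they are equal or connected by a chain of bigons. $G$ is reduced if none of its faces is a monogon or a bigon. A reduced graph $G$ is triangular if (i) every vertex has at most one boundary edge; (ii) every interior vertex has valency $6$; (iii) every boundary vertex has valency $5$; and (iv) every face of $G$ is a disk with three edges. $G$ is special if every vertex has at least two nonparallel boundary edges. **Proposition 3.1.** Let $G$ be a reduced graph in an annulus $A$. Then at least one of the following holds: (1) $G$ contains an interior vertex of valency at most $5$; (2) $G$ contains a boundary vertex of valency at most $4$ with exactly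 one boundary edge; (3) $G$ is triangular; (4) $G$ is special. -/

import Mathlib

/-!
Finite graphs in an annulus `A`, in the language of combinatorial maps (rotation systems).

The graph has fat vertices in the interior of `A`; every edge is an arc each of whose ends is
attached to a fat vertex or to one of the two boundary circles of `A`, at least one of them to a
fat vertex. Up to homeomorphism such a graph is given by its ends of edges (*darts*), by the cyclic
order of the darts around every fat vertex and around every boundary circle, and by the information
which closed curves bound the same face. Nothing is assumed to be connected: faces need not be
disks, vertices may be isolated, and boundary circles may be disjoint from the graph. Loops and
multiple edges are allowed.
-/

/-- The places where an end of an edge can be attached: a fat vertex `Sum.inl v`, or one of the two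
boundary circles `Sum.inr false`, `Sum.inr true` of the annulus. -/
abbrev AnnSite (V : Type*) := V ⊕ Bool

/-- The fat vertices (indexed by `V`) and two boundary circles, with the edges attached to them.
The elements of `D` are the ends of the edges, called darts. This describes an oriented surface:
a regular neighbourhood of the union of the graph and the two circles. -/
structure RibbonData (V D : Type*) where
  /-- the fat vertex or the boundary circle to which a dart is attached -/
  site : D → AnnSite V
  /-- the dart that follows a given one in the cyclic order around its site, all sites being given
  the orientation induced from the sphere that is obtained by capping off the boundary circles -/
  rot : Equiv.Perm D
  /-- the darts at one site form one cycle -/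
  rot_sameCycle_iff : ∀ d d', rot.SameCycle d d' ↔ site d = site d'
  /-- the other end of the edge of a dart -/
  opp : Equiv.Perm D
  opp_opp : ∀ d, opp (opp d) = d
  opp_ne : ∀ d, opp d ≠ d
  /-- at least one end of an edge is attached to a fat vertex -/
  meets_vertex : ∀ d, (site d).isLeft ∨ (site (opp d)).isLeft

namespace RibbonData

variable {V D : Type*} (R : RibbonData V D)

/-- An edge is a pair of opposite darts. -/
def Edge : Type _ := Quotient (Equiv.Perm.SameCycle.setoid R.opp)

/-- The edge to which a dart belongs. -/
def edge (d : D) : R.Edge := Quotient.mk (Equiv.Perm.SameCycle.setoid R.opp) d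

/-- Walking along the boundary of a face: run through an edge from the dart `d` to its other end,
then turn to the next dart at the site reached (where this site is a boundary circle, this means
to follow the segment of the boundary circle to the next edge). -/
def next : Equiv.Perm D := R.opp.trans R.rot

/-- The sites to which no dart is attached. -/
def IsolatedSite : Type _ := {s : AnnSite V // ∀ d, R.site d ≠ s}

/-- The boundary curves of the faces: the cycles of `next`, and one curve around every isolated
fat vertex and along every boundary circle that is disjoint from the graph. -/
def Walk : Type _ := Quotient (Equiv.Perm.SameCycle.setoid R.next) ⊕ R.IsolatedSite

/-- The boundary curve that runs along the edge of `d`, starting at `d`. -/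
def walkOf (d : D) : R.Walk :=
  Sum.inl (Quotient.mk (Equiv.Perm.SameCycle.setoid R.next) d)

/-- The curve `w` runs along the site `s`. -/
def Touches (w : R.Walk) (s : AnnSite V) : Prop :=
  (∃ d, R.walkOf d = w ∧ R.site d = s) ∨ ∃ i : R.IsolatedSite, Sum.inr i = w ∧ i.val = s

end RibbonData

/-- A finite graph in an annulus, with vertices `V`, darts (ends of edges) `D` and faces `F`.
A face is a sphere with holes, determined up to homeomorphism by its boundary curves, one for every
hole. Gluing the faces to the surface of the underlying `RibbonData` gives an oriented surface
with two boundary circles. It is an annulus if and only if it is connected and has Euler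
characteristic `0`. -/
structure AnnularGraph (V D F : Type*) [Finite V] [Finite D] [Fintype F] extends
    RibbonData V D where
  /-- the face that a curve bounds -/
  face : toRibbonData.Walk → F
  /-- every face has a boundary curve -/
  face_surjective : Function.Surjective face
  /-- the surface is connected: one gets from any site to any other one through faces -/
  connected : ∀ s t : AnnSite V, Relation.ReflTransGen
    (fun a b => ∃ w w' : toRibbonData.Walk,
      toRibbonData.Touches w a ∧ toRibbonData.Touches w' b ∧ face w = face w') s t
  /-- the Euler characteristic of the surface is `0`; the one of a face with `b` boundary curves
  is `2 - b` -/
  euler : (Nat.card V : ℤ) - (Nat.card toRibbonData.Edge : ℤ)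
    + ∑ f : F, (2 - (Nat.card {w : toRibbonData.Walk // face w = f} : ℤ)) = 0

namespace AnnularGraph

variable {V D F : Type*} [Finite V] [Finite D] [Fintype F] (G : AnnularGraph V D F)

/-- The valency of a vertex: the number of ends of edges at it (so a loop counts twice). -/
noncomputable def valency (v : V) : ℕ := Nat.card {d : D // G.site d = Sum.inl v}

/-- The boundary edges at a vertex `v`: one end is at `v`, the other one on a boundary circle. -/
def boundaryEdgesAt (v : V) : Set G.Edge :=
  {e | ∃ d, G.edge d = e ∧ G.site d = Sum.inl v ∧ ∃ i, G.site (G.opp d) = Sum.inr i}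

/-- A boundary vertex is incident to a boundary edge. -/
def IsBoundaryVertex (v : V) : Prop := (G.boundaryEdgesAt v).Nonempty

/-- An interior vertex is not incident to any boundary edge. -/
def IsInteriorVertex (v : V) : Prop := ¬ G.IsBoundaryVertex v

/-- The face `f` is a disk whose boundary contains exactly `k` edges of the graph. An edge that has
`f` on both sides is counted twice, and segments of the boundary of the annulus are not counted. -/
def IsPolygon (f : F) (k : ℕ) : Prop :=
  (∃! w, G.face w = f) ∧ Nat.card {d : D // G.face (G.walkOf d) = f} = k

/-- A graph is reduced if no face is a monogon or a bigon. -/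
def IsReduced : Prop := ∀ f, ¬ G.IsPolygon f 1 ∧ ¬ G.IsPolygon f 2

/-- Edges are parallel if they are connected by a chain of bigons. -/
def Parallel : G.Edge → G.Edge → Prop :=
  Relation.EqvGen fun e e' => ∃ f d d', G.IsPolygon f 2 ∧
    G.edge d = e ∧ G.edge d' = e' ∧ G.face (G.walkOf d) = f ∧ G.face (G.walkOf d') = f

/-- Triangular graphs (the notion is used for reduced graphs). -/
structure IsTriangular : Prop where
  boundaryEdges_le_one : ∀ v, (G.boundaryEdgesAt v).ncard ≤ 1
  valency_interior : ∀ v, G.IsInteriorVertex v → G.valency v = 6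
  valency_boundary : ∀ v, G.IsBoundaryVertex v → G.valency v = 5
  face_triangle : ∀ f, G.IsPolygon f 3

/-- A graph is special if every vertex has at least two nonparallel boundary edges. -/
def IsSpecial : Prop :=
  ∀ v, ∃ e ∈ G.boundaryEdgesAt v, ∃ e' ∈ G.boundaryEdgesAt v, ¬ G.Parallel e e'

end AnnularGraph

open Finset

/-! This is a discharging argument. A corner is a place at a vertex between two consecutive boundary
edges. A vertex with n edge ends, b boundary edges and c corners gets the excess n + b + c - 6; a
face of Euler characteristic χ with s sides and c corners gets 2s - 6χ - c. The corners cancel in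
the sum over everything, and `euler` makes the total 0 (`sum_excess`).

If (1) and (2) fail, no excess is negative: at vertices with b ≥ 2 because 2b ≤ n + c, at faces
because 2c ≤ s and a triangle has no corner. Hence all excesses vanish and, if there is a vertex,
every face is a triangle without corners or a quadrilateral with two
(`IsReduced.of_faceExcess_eq_zero`).

In this rigid situation b ≥ 2 spreads from one vertex to all (`forall_two_le_card_boundaryDarts`),
which gives (4), as distinct edges of a reduced graph are not parallel. If b ≤ 1 everywhere,
vanishing excess leaves no corners and the valencies required in (3), and all faces are triangles.
-/

/-- The size of a cycle of a permutation is the minimal period of its elements. -/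
theorem Equiv.Perm.card_sameCycle_eq_minimalPeriod {α : Type*} [Fintype α] (σ : Equiv.Perm α)
    (x : α) [DecidablePred fun y => σ.SameCycle x y] :
    #{y | σ.SameCycle x y} = Function.minimalPeriod σ x := by
  classical
  have hper : x ∈ Function.periodicPts σ := by
    refine ⟨orderOf σ, orderOf_pos σ, ?_⟩
    rw [Function.IsPeriodicPt, Function.IsFixedPt, ← Equiv.Perm.coe_pow, pow_orderOf_eq_one]
    rfl
  have hpos := Function.minimalPeriod_pos_of_mem_periodicPts hper
  rw [← Finset.card_range (Function.minimalPeriod σ x)]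
  symm
  apply Finset.card_bij (fun n _ => σ^[n] x)
  · intro n _
    simp only [mem_filter, mem_univ, true_and]
    exact ⟨n, by rw [zpow_natCast, Equiv.Perm.coe_pow]⟩
  · intro a ha b hb h
    exact Function.iterate_injOn_Iio_minimalPeriod (by simpa using ha) (by simpa using hb) h
  · intro y hy
    simp only [mem_filter, mem_univ, true_and] at hy
    obtain ⟨n, -, -, rfl⟩ := hy.exists_pow_eq'' 
    refine ⟨n % Function.minimalPeriod σ x, by simpa using Nat.mod_lt _ hpos, ?_⟩
    rw [Function.iterate_mod_minimalPeriod_eq, Equiv.Perm.coe_pow]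

/-! ### Counting darts, boundary darts and corners at vertices. -/

namespace RibbonData

variable {V D : Type*} (R : RibbonData V D)

/-- The dart is attached to a boundary circle. -/
def OnCircle (d : D) : Prop := ∃ i, R.site d = Sum.inr i

/-- The dart is attached to a vertex and its other end to a boundary circle. -/
def IsBoundaryDart (d : D) : Prop := R.OnCircle (R.opp d)

/-- A boundary dart that follows a boundary dart in the cyclic order around its vertex. -/
def IsCorner (d : D) : Prop := R.IsBoundaryDart d ∧ R.IsBoundaryDart (R.rot.symm d)

variable {R}

theorem next_apply (d : D) : R.next d = R.rot (R.opp d) := rfl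

theorem next_symm_apply (d : D) : R.next.symm d = R.opp (R.rot.symm d) := by
  rw [Equiv.symm_apply_eq, next_apply, R.opp_opp, Equiv.apply_symm_apply]

theorem site_rot (d : D) : R.site (R.rot d) = R.site d :=
  ((R.rot_sameCycle_iff _ _).1 ⟨1, by simp⟩).symm

theorem site_rot_symm (d : D) : R.site (R.rot.symm d) = R.site d := by
  rw [← site_rot, Equiv.apply_symm_apply]

theorem site_next (d : D) : R.site (R.next d) = R.site (R.opp d) := site_rot _

theorem not_onCircle_iff {d : D} : ¬ R.OnCircle d ↔ ∃ v, R.site d = Sum.inl v := by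
  unfold OnCircle
  rcases R.site d with v | i <;> simp

theorem OnCircle.not_isBoundaryDart {d : D} (h : R.OnCircle d) : ¬ R.IsBoundaryDart d := by
  rintro ⟨j, hj⟩
  obtain ⟨i, hi⟩ := h
  have := R.meets_vertex d
  simp [hi, hj] at this

theorem IsBoundaryDart.exists_site {d : D} (h : R.IsBoundaryDart d) :
    ∃ v, R.site d = Sum.inl v :=
  not_onCircle_iff.1 fun h' => h'.not_isBoundaryDart h

theorem isBoundaryDart_opp {d : D} : R.IsBoundaryDart (R.opp d) ↔ R.OnCircle d := by
  rw [IsBoundaryDart, R.opp_opp]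

theorem isBoundaryDart_rot_symm {d : D} :
    R.IsBoundaryDart (R.rot.symm d) ↔ R.OnCircle (R.next.symm d) := by
  rw [next_symm_apply]; rfl

theorem onCircle_next {d : D} : R.OnCircle (R.next d) ↔ R.IsBoundaryDart d := by
  rw [IsBoundaryDart, OnCircle, OnCircle, site_next]

theorem edge_eq_iff {d d' : D} : R.edge d = R.edge d' ↔ d' = d ∨ d' = R.opp d := by
  refine (Quotient.eq (r := Equiv.Perm.SameCycle.setoid R.opp)).trans ?_
  change R.opp.SameCycle d d' ↔ _
  constructor
  · rintro ⟨n, rfl⟩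
    have h2 : R.opp ^ (2 : ℤ) = 1 := by
      ext x
      rw [zpow_ofNat, pow_two, Equiv.Perm.mul_apply, R.opp_opp, Equiv.Perm.one_apply]
    rcases Int.even_or_odd' n with ⟨m, rfl | rfl⟩
    · left; rw [zpow_mul, h2, one_zpow, Equiv.Perm.one_apply]
    · right; rw [zpow_add, zpow_mul, h2, one_zpow, one_mul, zpow_one]
  · rintro (rfl | rfl)
    · exact .refl _ _
    · exact ⟨1, by simp⟩

theorem walkOf_eq_iff {d d' : D} : R.walkOf d = R.walkOf d' ↔ R.next.SameCycle d d' :=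
  Sum.inl_injective.eq_iff.trans (Quotient.eq (r := Equiv.Perm.SameCycle.setoid R.next))

theorem walkOf_next (d : D) : R.walkOf (R.next d) = R.walkOf d :=
  walkOf_eq_iff.2 (Equiv.Perm.sameCycle_apply_left.2 (.refl _ _))

theorem walkOf_next_symm (d : D) : R.walkOf (R.next.symm d) = R.walkOf d := by
  rw [← walkOf_next, Equiv.apply_symm_apply]

theorem walk_cases (w : R.Walk) : (∃ d, w = R.walkOf d) ∨ ∃ i, w = Sum.inr i := by
  rcases w with q | i
  · induction q using Quotient.inductionOn with
    | h d => exact .inl ⟨d, rfl⟩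
  · exact .inr ⟨i, rfl⟩

variable [Fintype D]

open Classical in
variable (R) in
/-- The boundary darts at a vertex. -/
noncomputable def boundaryDarts (v : V) : Finset D :=
  {d | R.site d = Sum.inl v ∧ R.IsBoundaryDart d}

open Classical in
variable (R) in
/-- The corners at a vertex. -/
noncomputable def cornersAt (v : V) : Finset D := {d | R.site d = Sum.inl v ∧ R.IsCorner d}

open Classical in
variable (R) in
/-- The darts at a vertex. -/
noncomputable def darts (v : V) : Finset D := {d | R.site d = Sum.inl v}

theorem mem_boundaryDarts {v : V} {d : D} :
    d ∈ R.boundaryDarts v ↔ R.site d = Sum.inl v ∧ R.IsBoundaryDart d := by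
  simp [boundaryDarts]

theorem mem_cornersAt {v : V} {d : D} :
    d ∈ R.cornersAt v ↔ R.site d = Sum.inl v ∧ R.IsCorner d := by
  simp [cornersAt]

theorem mem_darts {v : V} {d : D} : d ∈ R.darts v ↔ R.site d = Sum.inl v := by
  simp [darts]

theorem cornersAt_eq_inter [DecidableEq D] (v : V) :
    R.cornersAt v = R.boundaryDarts v ∩ (R.boundaryDarts v).map R.rot.toEmbedding := by
  ext d
  simp only [mem_cornersAt, IsCorner, mem_inter, mem_boundaryDarts, mem_map_equiv, site_rot_symm]
  tauto

theorem boundaryDarts_union_subset [DecidableEq D] (v : V) :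
    R.boundaryDarts v ∪ (R.boundaryDarts v).map R.rot.toEmbedding ⊆ R.darts v := by
  intro d
  simp only [mem_union, mem_boundaryDarts, mem_map_equiv, site_rot_symm, mem_darts]
  tauto

theorem card_union_add_card_cornersAt [DecidableEq D] (v : V) :
    #(R.boundaryDarts v ∪ (R.boundaryDarts v).map R.rot.toEmbedding) + #(R.cornersAt v) =
      2 * #(R.boundaryDarts v) := by
  rw [cornersAt_eq_inter, card_union_add_card_inter, card_map, two_mul]

/-- The boundary darts and their successors under `rot` all lie at `v`, and these two sets overlap
exactly in the corners. -/
theorem two_mul_card_boundaryDarts_le (v : V) :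
    2 * #(R.boundaryDarts v) ≤ #(R.darts v) + #(R.cornersAt v) := by
  classical
  rw [← card_union_add_card_cornersAt]
  exact Nat.add_le_add_right (card_le_card (boundaryDarts_union_subset v)) _

/-- If there are as few corners as possible at a vertex, then each dart that is not a boundary dart
has boundary darts on both sides. -/
theorem isBoundaryDart_neighbours {v : V}
    (hv : 2 * #(R.boundaryDarts v) = #(R.darts v) + #(R.cornersAt v)) {d : D}
    (hd : R.site d = Sum.inl v) (hb : ¬ R.IsBoundaryDart d) :
    R.IsBoundaryDart (R.rot.symm d) ∧ R.IsBoundaryDart (R.rot d) := by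
  classical
  have hu : R.boundaryDarts v ∪ (R.boundaryDarts v).map R.rot.toEmbedding = R.darts v := by
    apply eq_of_subset_of_card_le (boundaryDarts_union_subset v)
    have := R.card_union_add_card_cornersAt v
    omega
  have key : ∀ d, R.site d = Sum.inl v → R.IsBoundaryDart d ∨ R.IsBoundaryDart (R.rot.symm d) := by
    intro d hd
    have := hu.ge (mem_darts.2 hd)
    simp only [mem_union, mem_boundaryDarts, mem_map_equiv] at this
    tauto
  refine ⟨(key d hd).resolve_left hb, (key (R.rot d) ?_).resolve_right ?_⟩
  · rw [site_rot, hd]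
  · rwa [Equiv.symm_apply_apply]

/-- A vertex with a fixed point of a power of the rotation has small valency. -/
theorem card_darts_le {v : V} {d : D} (hd : R.site d = Sum.inl v) {n : ℕ} (hn : 0 < n)
    (h : R.rot^[n] d = d) : #(R.darts v) ≤ n := by
  classical
  have : R.darts v = ({y | R.rot.SameCycle d y} : Finset D) := by
    ext y
    simp [mem_darts, R.rot_sameCycle_iff, hd, eq_comm]
  rw [this, Equiv.Perm.card_sameCycle_eq_minimalPeriod]
  exact Function.IsPeriodicPt.minimalPeriod_le hn h

/-- A vertex with two boundary darts at a small distance has two boundary darts unless its valency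
is small. -/
theorem two_le_card_boundaryDarts {v : V} {d : D} (hd : R.site d = Sum.inl v) {n : ℕ} (hn : 0 < n)
    (hb : R.IsBoundaryDart d) (hb' : R.IsBoundaryDart (R.rot^[n] d)) (hv : n < #(R.darts v)) :
    2 ≤ #(R.boundaryDarts v) := by
  have hs : R.site (R.rot^[n] d) = Sum.inl v := by
    rw [← hd]
    clear * -
    induction n with
    | zero => rfl
    | succ n ih => rw [Function.iterate_succ_apply', site_rot, ih]
  refine one_lt_card.2 ⟨_, mem_boundaryDarts.2 ⟨hd, hb⟩, _, mem_boundaryDarts.2 ⟨hs, hb'⟩, ?_⟩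
  intro h
  exact absurd (card_darts_le hd hn h.symm) (by omega)

theorem card_darts_eq_two_mul_card_edge : Fintype.card D = 2 * Nat.card R.Edge := by
  classical
  have : Finite R.Edge := Quotient.finite _
  have : Fintype R.Edge := Fintype.ofFinite _
  rw [Nat.card_eq_fintype_card, ← card_univ, ← card_univ,
    card_eq_sum_card_fiberwise (f := R.edge) (t := univ) (by simp), mul_comm]
  refine sum_const_nat fun e _ => ?_
  obtain ⟨d, rfl⟩ : ∃ d, R.edge d = e := Quotient.exists_rep e
  rw [card_eq_two]
  refine ⟨d, R.opp d, (R.opp_ne d).symm, ?_⟩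
  ext d'
  simp only [mem_filter, mem_univ, true_and, mem_insert, mem_singleton]
  rw [eq_comm, edge_eq_iff]

theorem sum_card_darts [Fintype V] (f : V → Finset D) (P : D → Prop) [DecidablePred P]
    (hP : ∀ d, P d → ∃ v, R.site d = Sum.inl v)
    (hf : ∀ v d, d ∈ f v ↔ R.site d = Sum.inl v ∧ P d) : ∑ v, #(f v) = #{d | P d} := by
  classical
  rw [← card_biUnion]
  · congr 1
    ext d
    simp only [mem_biUnion, mem_univ, true_and, hf, mem_filter, exists_and_right]
    exact ⟨fun h => h.2, fun h => ⟨hP d h, h⟩⟩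
  · intro a _ b _ hab
    rw [Function.onFun, disjoint_left]
    intro d ha hb
    exact hab (Sum.inl_injective (((hf _ _).1 ha).1.symm.trans ((hf _ _).1 hb).1))

/-- Every dart lies at a vertex or on a circle, and `opp` matches those on circles with the boundary
darts. -/
theorem sum_card_darts_add_card_boundaryDarts [Fintype V] :
    ∑ v, (#(R.darts v) + #(R.boundaryDarts v)) = Fintype.card D := by
  classical
  rw [sum_add_distrib, sum_card_darts R.darts (fun d => ¬ R.OnCircle d)
      (fun d => not_onCircle_iff.1)
      (fun v d => by rw [mem_darts, not_onCircle_iff]; exact ⟨fun h => ⟨h, v, h⟩, And.left⟩),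
    sum_card_darts R.boundaryDarts R.IsBoundaryDart (fun d h => h.exists_site)
      (fun v d => mem_boundaryDarts), ← card_univ,
    ← card_filter_add_card_filter_not (s := univ) R.OnCircle, add_comm]
  congr 1
  refine card_bij (fun d _ => R.opp d) ?_ ?_ ?_
  · intro d hd
    rw [mem_filter] at hd ⊢
    exact ⟨mem_univ _, hd.2⟩
  · simp
  · intro d hd
    exact ⟨R.opp d, by simpa [isBoundaryDart_opp] using hd, R.opp_opp d⟩

end RibbonData

/-! ### Boundary curves and isolated sites. -/

namespace RibbonData

variable {V D : Type*} (R : RibbonData V D)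

instance [Finite V] [Finite D] : Finite R.Walk := by
  have h1 : Finite (Quotient (Equiv.Perm.SameCycle.setoid R.next)) := Quotient.finite _
  have h2 : Finite R.IsolatedSite := Subtype.finite
  exact @Finite.instSum _ _ h1 h2

theorem touches_inr_iff (i : R.IsolatedSite) (s : AnnSite V) :
    R.Touches (Sum.inr i) s ↔ s = i.val := by
  constructor
  · rintro (⟨d, h, -⟩ | ⟨j, h, rfl⟩)
    · exact absurd h Sum.inl_ne_inr
    · rw [Sum.inr_injective h]
  · rintro rfl
    exact .inr ⟨i, rfl, rfl⟩

theorem touches_walkOf_iff (d : D) (s : AnnSite V) :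
    R.Touches (R.walkOf d) s ↔ ∃ d', R.next.SameCycle d d' ∧ R.site d' = s := by
  constructor
  · rintro (⟨d', h, hs⟩ | ⟨j, h, rfl⟩)
    · exact ⟨d', walkOf_eq_iff.1 h.symm, hs⟩
    · exact absurd h Sum.inr_ne_inl
  · rintro ⟨d', h, hs⟩
    exact .inl ⟨d', (walkOf_eq_iff.2 h).symm, hs⟩

theorem eq_of_touches_isolatedSite {i : R.IsolatedSite} {w : R.Walk} (h : R.Touches w i.val) :
    w = Sum.inr i := by
  rcases h with ⟨d, -, h⟩ | ⟨j, rfl, h⟩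
  · exact absurd h (i.2 d)
  · rw [Subtype.ext h]

end RibbonData

/-! ### Valency, boundary edges and faces in terms of darts. -/

namespace AnnularGraph

open RibbonData

variable {V D F : Type*} [Finite V] [Fintype D] [Fintype F] (G : AnnularGraph V D F)

theorem valency_eq_card_darts (v : V) : G.valency v = #(G.darts v) := by
  classical
  rw [valency, Nat.card_eq_fintype_card, Fintype.card_subtype, RibbonData.darts]

theorem ncard_boundaryEdgesAt (v : V) : (G.boundaryEdgesAt v).ncard = #(G.boundaryDarts v) := by
  have : G.boundaryEdgesAt v = G.edge '' (G.boundaryDarts v : Set D) := by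
    ext e
    simp only [boundaryEdgesAt, Set.mem_ofPred_eq, Set.mem_image, mem_coe, mem_boundaryDarts]
    exact ⟨fun ⟨d, h, h'⟩ => ⟨d, h', h⟩, fun ⟨d, h', h⟩ => ⟨d, h, h'⟩⟩
  rw [this, Set.InjOn.ncard_image, Set.ncard_coe_finset]
  intro d hd d' hd' h
  rw [mem_coe, mem_boundaryDarts] at hd hd'
  rcases edge_eq_iff.1 h with rfl | rfl
  · rfl
  · exact absurd hd'.2 hd.2.not_isBoundaryDart

theorem isBoundaryVertex_iff (v : V) : G.IsBoundaryVertex v ↔ 0 < #(G.boundaryDarts v) := by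
  have : Finite G.Edge := Quotient.finite _
  rw [← ncard_boundaryEdgesAt, Set.ncard_pos, IsBoundaryVertex]

theorem IsReduced.eq_of_parallel {G : AnnularGraph V D F} (hG : G.IsReduced) {e e' : G.Edge}
    (h : G.Parallel e e') : e = e' := by
  induction h with
  | rel _ _ h => obtain ⟨f, _, _, hf, _⟩ := h; exact absurd hf (hG f).2
  | refl => rfl
  | symm _ _ _ h => exact h.symm
  | trans _ _ _ _ _ h h' => exact h.trans h'

theorem IsReduced.isSpecial {G : AnnularGraph V D F} (hG : G.IsReduced)
    (h : ∀ v, 2 ≤ #(G.boundaryDarts v)) : G.IsSpecial := by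
  intro v
  have : Finite G.Edge := Quotient.finite _
  have h1 := h v
  rw [← ncard_boundaryEdgesAt] at h1
  obtain ⟨e, he, e', he', hne⟩ := (Set.one_lt_ncard_iff_nontrivial).1 h1
  exact ⟨e, he, e', he', fun h => hne (hG.eq_of_parallel h)⟩

open Classical in
/-- The sides of a face, each given by the dart at its start. -/
noncomputable def sides (f : F) : Finset D := {d | G.face (G.walkOf d) = f}

open Classical in
/-- The corners in a face between two consecutive boundary edges at a vertex. -/
noncomputable def cornersIn (f : F) : Finset D := {d | G.face (G.walkOf d) = f ∧ G.IsCorner d}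

/-- The Euler characteristic of a face. -/
noncomputable def faceChar (f : F) : ℤ := 2 - (Nat.card {w : G.Walk // G.face w = f} : ℤ)

variable {G}

theorem mem_sides {f : F} {d : D} : d ∈ G.sides f ↔ G.face (G.walkOf d) = f := by
  simp [sides]

theorem mem_cornersIn {f : F} {d : D} : d ∈ G.cornersIn f ↔ d ∈ G.sides f ∧ G.IsCorner d := by
  simp [cornersIn, sides]

theorem next_mem_sides {f : F} {d : D} : G.next d ∈ G.sides f ↔ d ∈ G.sides f := by
  rw [mem_sides, mem_sides, walkOf_next]

theorem next_symm_mem_sides {f : F} {d : D} : G.next.symm d ∈ G.sides f ↔ d ∈ G.sides f := by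
  rw [mem_sides, mem_sides, walkOf_next_symm]

theorem isPolygon_iff {f : F} {k : ℕ} :
    G.IsPolygon f k ↔ (∃! w, G.face w = f) ∧ #(G.sides f) = k := by
  classical
  rw [IsPolygon, Nat.card_eq_fintype_card, Fintype.card_subtype, sides]

variable (G) in
theorem sum_card_sides : ∑ f, #(G.sides f) = Fintype.card D := by
  classical
  rw [← card_univ, card_eq_sum_card_fiberwise (f := fun d => G.face (G.walkOf d)) (t := univ)
    (by simp)]
  rfl

variable (G) in
theorem sum_card_cornersIn [Fintype V] : ∑ f, #(G.cornersIn f) = ∑ v, #(G.cornersAt v) := by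
  classical
  rw [RibbonData.sum_card_darts G.cornersAt G.IsCorner (fun d h => h.1.exists_site)
      (fun v d => mem_cornersAt),
    card_eq_sum_card_fiberwise (f := fun d => G.face (G.walkOf d)) (t := univ) (by simp)]
  refine sum_congr rfl fun f _ => ?_
  congr 1
  ext d
  simp [cornersIn, and_comm]

variable (G) in
theorem sum_faceChar : ∑ f, G.faceChar f = Nat.card G.Edge - Nat.card V := by
  have := G.euler
  unfold faceChar
  linarith

theorem mem_sides_of_mem_cornersIn_union [DecidableEq D] {f : F} {d : D}
    (hd : d ∈ G.cornersIn f ∪ (G.cornersIn f).map G.next.symm.toEmbedding) :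
    d ∈ G.sides f ∧ (G.OnCircle d ∨ G.IsBoundaryDart d) := by
  simp only [mem_union, mem_map_equiv, Equiv.symm_symm, mem_cornersIn, next_mem_sides,
    RibbonData.IsCorner, isBoundaryDart_rot_symm, Equiv.symm_apply_apply] at hd
  tauto

end AnnularGraph

/-! ### Corners in faces, and disk faces. -/

namespace AnnularGraph

open RibbonData

variable {V D F : Type*} [Finite V] [Fintype D] [Fintype F] {G : AnnularGraph V D F}

/-- A corner `d` uses two sides of its face: `d` itself, which starts at a vertex, and the preceding
side, which starts on a circle. So no side is used twice. -/
theorem card_cornersIn_union [DecidableEq D] (f : F) :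
    #(G.cornersIn f ∪ (G.cornersIn f).map G.next.symm.toEmbedding) = 2 * #(G.cornersIn f) := by
  rw [card_union_of_disjoint, card_map, two_mul]
  rw [disjoint_left]
  intro d hd hd'
  simp only [mem_map_equiv, Equiv.symm_symm, mem_cornersIn, RibbonData.IsCorner,
    isBoundaryDart_rot_symm, Equiv.symm_apply_apply] at hd hd'
  exact hd'.2.2.not_isBoundaryDart hd.2.1

variable (G) in
theorem two_mul_card_cornersIn_le (f : F) : 2 * #(G.cornersIn f) ≤ #(G.sides f) := by
  classical
  rw [← card_cornersIn_union]
  exact card_le_card fun d hd => (mem_sides_of_mem_cornersIn_union hd).1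

/-- In the case of equality every side is used by a corner, hence is a side of a boundary edge. -/
theorem onCircle_or_isBoundaryDart {f : F} (hf : #(G.sides f) = 2 * #(G.cornersIn f)) {d : D}
    (hd : d ∈ G.sides f) : G.OnCircle d ∨ G.IsBoundaryDart d := by
  classical
  have h := eq_of_subset_of_card_le
    (fun d (hd : d ∈ G.cornersIn f ∪ (G.cornersIn f).map G.next.symm.toEmbedding) =>
      (mem_sides_of_mem_cornersIn_union hd).1) (by rw [card_cornersIn_union, hf])
  exact (mem_sides_of_mem_cornersIn_union (h.ge hd)).2

/-- The only boundary curve of the disk touches nothing but the isolated site, so a chain as in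
`connected` never leaves that site. -/
theorem site_eq_of_disk_isolated {f : F} (hf : ∃! w, G.face w = f) {i : G.IsolatedSite}
    (hi : G.face (Sum.inr i) = f) (s : AnnSite V) : s = i.val := by
  induction G.connected i.val s with
  | refl => rfl
  | tail _ h ih =>
    obtain ⟨w, w', hw, hw', h⟩ := h
    rw [ih] at hw
    obtain rfl := G.eq_of_touches_isolatedSite hw
    obtain rfl := hf.unique hi (h ▸ hi)
    exact (G.touches_inr_iff _ _).1 hw'

theorem exists_walkOf_of_disk {f : F} (hf : ∃! w, G.face w = f) {w : G.Walk} (hw : G.face w = f) :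
    ∃ d, w = G.walkOf d := by
  refine (walk_cases w).resolve_right ?_
  rintro ⟨i, rfl⟩
  -- The two boundary circles are already two different sites.
  have h1 := site_eq_of_disk_isolated hf hw (Sum.inr false)
  have h2 := site_eq_of_disk_isolated hf hw (Sum.inr true)
  simpa using h1.trans h2.symm

theorem sameCycle_of_disk {f : F} (hf : ∃! w, G.face w = f) {d d' : D} (hd : d ∈ G.sides f)
    (hd' : d' ∈ G.sides f) : G.next.SameCycle d d' :=
  walkOf_eq_iff.1 (hf.unique (mem_sides.1 hd) (mem_sides.1 hd'))

theorem card_sides_pos_of_disk {f : F} (hf : ∃! w, G.face w = f) : 0 < #(G.sides f) := by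
  obtain ⟨w, hw, -⟩ := id hf
  obtain ⟨d, rfl⟩ := exists_walkOf_of_disk hf hw
  exact card_pos.2 ⟨d, mem_sides.2 hw⟩

theorem iterate_next_of_disk {f : F} (hf : ∃! w, G.face w = f) {d : D} (hd : d ∈ G.sides f) :
    G.next^[#(G.sides f)] d = d := by
  classical
  have : G.sides f = ({y | G.next.SameCycle d y} : Finset D) := by
    ext y
    simp only [mem_filter, mem_univ, true_and]
    refine ⟨sameCycle_of_disk hf hd, fun h => ?_⟩
    rw [mem_sides] at hd ⊢
    rw [← hd, walkOf_eq_iff.2 h]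
  rw [this, Equiv.Perm.card_sameCycle_eq_minimalPeriod]
  exact Function.iterate_minimalPeriod

/-- A triangle has no corner between two boundary edges. -/
theorem card_cornersIn_triangle {f : F} (hf : ∃! w, G.face w = f) (h3 : #(G.sides f) = 3) :
    #(G.cornersIn f) = 0 := by
  rw [card_eq_zero, eq_empty_iff_forall_notMem]
  intro d hd
  rw [mem_cornersIn, RibbonData.IsCorner, isBoundaryDart_rot_symm] at hd
  obtain ⟨hd, hb, hc⟩ := hd
  -- The sides before and after `d` both start on circles. In a triangle the former follows the
  -- latter, so the edge of `next d` would have both ends on circles.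
  have h := iterate_next_of_disk hf hd
  rw [h3] at h
  have h' : G.next.symm d = G.next (G.next d) := by
    rw [Equiv.symm_apply_eq]; exact h.symm
  rw [h', onCircle_next] at hc
  exact (onCircle_next.2 hb).not_isBoundaryDart hc

theorem faceChar_eq_one_iff {f : F} : G.faceChar f = 1 ↔ ∃! w, G.face w = f := by
  have h : G.faceChar f = 1 ↔ Nat.card {w : G.Walk // G.face w = f} = 1 := by
    unfold faceChar; omega
  rw [h, Nat.card_eq_one_iff_unique, ← unique_subtype_iff_existsUnique,
    unique_iff_subsingleton_and_nonempty]

theorem faceChar_le_one (f : F) : G.faceChar f ≤ 1 := by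
  obtain ⟨w, hw⟩ := G.face_surjective f
  have : 0 < Nat.card {w : G.Walk // G.face w = f} := Nat.card_pos_iff.2 ⟨⟨w, hw⟩, inferInstance⟩
  unfold faceChar
  omega

/-- If a face is an annulus without sides, then there are no vertices. -/
theorem isEmpty_of_annulus {f : F} (h0 : #(G.sides f) = 0) (hf : G.faceChar f = 0) :
    IsEmpty V := by
  have hiso : ∀ w, G.face w = f → ∃ i : G.IsolatedSite, w = Sum.inr i := by
    intro w hw
    refine (walk_cases w).resolve_left ?_
    rintro ⟨d, rfl⟩
    rw [card_eq_zero] at h0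
    simpa [h0] using mem_sides.2 hw
  have h2 : Nat.card {w : G.Walk // G.face w = f} = 2 := by
    unfold faceChar at hf; omega
  obtain ⟨⟨w₁, h₁⟩, ⟨w₂, h₂⟩, -, hu⟩ := Nat.card_eq_two_iff.1 h2
  obtain ⟨i₁, rfl⟩ := hiso w₁ h₁
  obtain ⟨i₂, rfl⟩ := hiso w₂ h₂
  have hw : ∀ w, G.face w = f → w = Sum.inr i₁ ∨ w = Sum.inr i₂ := by
    intro w hw
    have : (⟨w, hw⟩ : {w : G.Walk // G.face w = f}) ∈ _ := hu.ge (Set.mem_univ _)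
    rw [Set.mem_insert_iff, Set.mem_singleton_iff] at this
    exact this.imp (congrArg Subtype.val) (congrArg Subtype.val)
  have hs : ∀ s, s = i₁.val ∨ s = i₂.val := by
    intro s
    induction G.connected i₁.val s with
    | refl => exact .inl rfl
    | tail _ h ih =>
      obtain ⟨w, w', hw₁, hw', h⟩ := h
      have hwf : G.face w = f := by
        rcases ih with ih | ih <;> rw [ih] at hw₁ <;>
          rw [G.eq_of_touches_isolatedSite hw₁] <;> assumption
      rcases hw w' (h ▸ hwf) with rfl | rfl
      · exact .inl ((G.touches_inr_iff _ _).1 hw')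
      · exact .inr ((G.touches_inr_iff _ _).1 hw')
  -- A vertex and the two circles would be three distinct sites, and only two are available.
  refine ⟨fun v => ?_⟩
  have a := hs (Sum.inl v)
  have b := hs (Sum.inr false)
  have c := hs (Sum.inr true)
  grind

/-! ### Excesses of faces and vertices. -/

variable (G) in
/-- The excess of a face over a triangle, diminished by the number of its corners. -/
noncomputable def faceExcess (f : F) : ℤ :=
  2 * #(G.sides f) - 6 * G.faceChar f - #(G.cornersIn f)

theorem IsReduced.three_le_card_sides (hG : G.IsReduced) {f : F} (hf : ∃! w, G.face w = f) :
    3 ≤ #(G.sides f) := by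
  have h0 := card_sides_pos_of_disk hf
  have h1 : #(G.sides f) ≠ 1 := fun h => (hG f).1 (isPolygon_iff.2 ⟨hf, h⟩)
  have h2 : #(G.sides f) ≠ 2 := fun h => (hG f).2 (isPolygon_iff.2 ⟨hf, h⟩)
  omega

/-- For a disk with s ≥ 4, c ≤ s/2 gives 2s - 6 - c ≥ 3s/2 - 6 ≥ 0, with equality only for s = 4, c
= 2. For a triangle c = 0. Any other face has χ ≤ 0. -/
theorem IsReduced.faceExcess_nonneg (hG : G.IsReduced) (f : F) : 0 ≤ G.faceExcess f := by
  have h2 := G.two_mul_card_cornersIn_le f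
  have hle := G.faceChar_le_one f
  unfold faceExcess
  by_cases hf : ∃! w, G.face w = f
  · have h3 := hG.three_le_card_sides hf
    have h3' := card_cornersIn_triangle hf
    omega
  · have := mt faceChar_eq_one_iff.1 hf
    omega

/-- Among the faces that are not disks, only an annulus without sides has excess 0, and it does not
occur when there is a vertex. -/
theorem IsReduced.of_faceExcess_eq_zero [Nonempty V] (hG : G.IsReduced) {f : F}
    (h : G.faceExcess f = 0) : (∃! w, G.face w = f) ∧
      (#(G.cornersIn f) = 0 ∧ #(G.sides f) = 3 ∨ #(G.cornersIn f) = 2 ∧ #(G.sides f) = 4) := by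
  have h2 := G.two_mul_card_cornersIn_le f
  have hle := G.faceChar_le_one f
  unfold faceExcess at h
  by_cases hf : ∃! w, G.face w = f
  · have h3 := hG.three_le_card_sides hf
    have h3' := card_cornersIn_triangle hf
    have := faceChar_eq_one_iff.2 hf
    exact ⟨hf, by omega⟩
  · have := mt faceChar_eq_one_iff.1 hf
    have := isEmpty_of_annulus (G := G) (f := f) (by omega) (by omega)
    exact absurd this (not_isEmpty_of_nonempty V)

variable (G) in
/-- The excess of the numbers of edges and corners at a vertex. -/
noncomputable def vertexExcess (v : V) : ℤ :=
  #(G.darts v) + #(G.boundaryDarts v) + #(G.cornersAt v) - 6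

variable (G) in
theorem sum_excess [Fintype V] : ∑ v, G.vertexExcess v + ∑ f, G.faceExcess f = 0 := by
  have h1 := G.sum_card_darts_add_card_boundaryDarts
  have h2 := G.sum_card_cornersIn
  have h3 := G.sum_card_sides
  have h4 := G.sum_faceChar
  have h5 := G.card_darts_eq_two_mul_card_edge
  zify at h1 h2 h3 h5
  rw [Nat.card_eq_fintype_card (α := V)] at h4
  simp only [vertexExcess, faceExcess, sum_sub_distrib, sum_add_distrib, ← mul_sum, sum_const,
    card_univ, nsmul_eq_mul] at h1 ⊢
  linarith

/-! ### Spreading of the vertices with at least two boundary edges. -/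

/-- If there are no excesses, then an edge between two vertices one of which has at least two
boundary edges also ends at such a vertex at its other end. -/
theorem two_le_card_boundaryDarts_of_edge
    (hface : ∀ f, (∃! w, G.face w = f) ∧
      (#(G.cornersIn f) = 0 ∧ #(G.sides f) = 3 ∨ #(G.cornersIn f) = 2 ∧ #(G.sides f) = 4))
    (hval : ∀ v, #(G.boundaryDarts v) ≤ 1 → 5 ≤ #(G.darts v))
    (hv : ∀ v, 2 ≤ #(G.boundaryDarts v) →
      2 * #(G.boundaryDarts v) = #(G.darts v) + #(G.cornersAt v))
    {g : D} {v u : V} (h2 : 2 ≤ #(G.boundaryDarts v)) (hg : G.site g = Sum.inl v)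
    (hu : G.site (G.opp g) = Sum.inl u) : 2 ≤ #(G.boundaryDarts u) := by
  have hgb : ¬ G.IsBoundaryDart g := by rw [IsBoundaryDart, not_onCircle_iff]; exact ⟨u, hu⟩
  have hgc : ¬ G.OnCircle g := by rw [not_onCircle_iff]; exact ⟨v, hg⟩
  have hoc : ¬ G.OnCircle (G.opp g) := hgb
  have hob : ¬ G.IsBoundaryDart (G.opp g) := by rwa [isBoundaryDart_opp]
  have tri : ∀ d, ¬ G.OnCircle d → ¬ G.IsBoundaryDart d → G.next (G.next (G.next d)) = d := by
    intro d hc hb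
    obtain ⟨hf, h⟩ := hface (G.face (G.walkOf d))
    have hd : d ∈ G.sides (G.face (G.walkOf d)) := mem_sides.2 rfl
    rcases h with ⟨-, h⟩ | ⟨h, h'⟩
    · simpa [h] using iterate_next_of_disk hf hd
    -- All sides of a quadrilateral with two corners belong to boundary edges, so `d` is not among
    -- them.
    · have := onCircle_or_isBoundaryDart (by omega) hd
      tauto
  obtain ⟨hb1, hb2⟩ := isBoundaryDart_neighbours (hv v h2) hg hgb
  have t1 := tri _ hoc hob
  have t2 := tri _ hgc hgb
  by_contra hlt
  have h5 := hval u (by omega)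
  apply hlt
  -- Both neighbours of `g` at `v` are boundary edges, so each of the triangles along `g` has a
  -- boundary edge at `u` as its third side. These are the neighbours `c` and `rot (rot c)` of `opp
  -- g`, which differ since `u` has valency greater than 2.
  set c := G.opp (G.next (G.next (G.opp g))) with hc
  have hcrot : G.rot c = G.opp g := by rw [hc, ← next_apply, t1]
  have hcs : G.site c = Sum.inl u := by rw [← site_rot, hcrot, hu]
  have hcb : G.IsBoundaryDart c := by
    rw [hc, isBoundaryDart_opp, onCircle_next, next_apply, G.opp_opp]
    exact hb2
  refine G.two_le_card_boundaryDarts (n := 2) hcs (by norm_num) hcb ?_ (by omega)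
  change G.IsBoundaryDart (G.rot (G.rot c))
  rw [hcrot, ← next_apply, ← onCircle_next]
  have : G.next (G.next g) = G.next.symm g := by rw [Equiv.eq_symm_apply, t2]
  rw [this, ← isBoundaryDart_rot_symm]
  exact hb1

variable (G) in
/-- The dart belongs to an edge at a vertex with at least two boundary edges. -/
def IsSpecialDart (d : D) : Prop :=
  ∃ v, 2 ≤ #(G.boundaryDarts v) ∧ (G.site d = Sum.inl v ∨ G.site (G.opp d) = Sum.inl v)

theorem isSpecialDart_opp {d : D} : G.IsSpecialDart (G.opp d) ↔ G.IsSpecialDart d := by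
  simp only [IsSpecialDart, G.opp_opp, or_comm]

/-- The main case is a boundary edge from `v` to a circle, after which the face continues to a
vertex `u`. In a triangle the third side joins `u` to `v`. In a quadrilateral all sides are boundary
edges, so two consecutive ones meet at `u`. -/
theorem isSpecialDart_next
    (hface : ∀ f, (∃! w, G.face w = f) ∧
      (#(G.cornersIn f) = 0 ∧ #(G.sides f) = 3 ∨ #(G.cornersIn f) = 2 ∧ #(G.sides f) = 4))
    (hval : ∀ v, #(G.boundaryDarts v) ≤ 1 → 5 ≤ #(G.darts v))
    (hv : ∀ v, 2 ≤ #(G.boundaryDarts v) →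
      2 * #(G.boundaryDarts v) = #(G.darts v) + #(G.cornersAt v))
    {d : D} (hd : G.IsSpecialDart d) : G.IsSpecialDart (G.next d) := by
  have hedge := fun g v u => two_le_card_boundaryDarts_of_edge (g := g) (v := v) (u := u)
    hface hval hv
  obtain ⟨v, h2, hd | hd⟩ := hd
  swap
  · exact ⟨v, h2, .inl (by rw [site_next, hd])⟩
  by_cases hb : G.IsBoundaryDart d
  swap
  · obtain ⟨u, hu⟩ := not_onCircle_iff.1 hb
    exact ⟨u, hedge d v u h2 hd hu, .inl (by rw [site_next, hu])⟩
  obtain ⟨u, hu⟩ := not_onCircle_iff.1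
    fun h => (onCircle_next.2 hb).not_isBoundaryDart (d := G.next d) h
  refine ⟨u, ?_, .inr hu⟩
  obtain ⟨hf, h⟩ := hface (G.face (G.walkOf d))
  have hdf : d ∈ G.sides (G.face (G.walkOf d)) := mem_sides.2 rfl
  have hit := iterate_next_of_disk hf hdf
  have hprev : G.site (G.opp (G.next.symm d)) = Sum.inl v := by
    rw [← site_next, Equiv.apply_symm_apply, hd]
  rcases h with ⟨-, h⟩ | ⟨h, h'⟩
  · rw [h] at hit
    have hp : G.next.symm d = G.next (G.next d) := by rw [Equiv.symm_apply_eq]; exact hit.symm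
    rw [hp] at hprev
    refine hedge (G.opp (G.next (G.next d))) v u h2 hprev ?_
    rw [G.opp_opp, site_next, hu]
  · rw [h'] at hit
    have hp : G.next (G.next (G.next d)) = G.next.symm d := by
      rw [Equiv.eq_symm_apply]; exact hit
    have hc : G.OnCircle (G.next.symm d) := by
      refine (onCircle_or_isBoundaryDart (by omega) (next_symm_mem_sides.2 hdf)).resolve_right ?_
      rw [IsBoundaryDart, not_onCircle_iff]
      exact ⟨v, hprev⟩
    rw [← hp, onCircle_next] at hc
    by_contra hlt
    have h5 := hval u (by omega)
    apply hlt
    refine G.two_le_card_boundaryDarts (n := 1) hu one_pos ?_ hc (by omega)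
    rw [isBoundaryDart_opp, onCircle_next]
    exact hb

/-- If there are no excesses and some vertex has at least two boundary edges, then every vertex
does. -/
theorem forall_two_le_card_boundaryDarts
    (hface : ∀ f, (∃! w, G.face w = f) ∧
      (#(G.cornersIn f) = 0 ∧ #(G.sides f) = 3 ∨ #(G.cornersIn f) = 2 ∧ #(G.sides f) = 4))
    (hval : ∀ v, #(G.boundaryDarts v) ≤ 1 → 5 ≤ #(G.darts v))
    (hv : ∀ v, 2 ≤ #(G.boundaryDarts v) →
      2 * #(G.boundaryDarts v) = #(G.darts v) + #(G.cornersAt v))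
    {v₀ : V} (h₀ : 2 ≤ #(G.boundaryDarts v₀)) (v : V) : 2 ≤ #(G.boundaryDarts v) := by
  have hnext : ∀ d d', G.next.SameCycle d d' → G.IsSpecialDart d → G.IsSpecialDart d' := by
    intro d d' h hd
    obtain ⟨n, -, -, rfl⟩ := h.exists_pow_eq''
    clear h
    induction n with
    | zero => exact hd
    | succ n ih =>
      rw [pow_succ', Equiv.Perm.mul_apply]
      exact isSpecialDart_next hface hval hv ih
  have hrot : ∀ d d', G.site d = G.site d' → G.IsSpecialDart d → G.IsSpecialDart d' := by
    intro d d' h hd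
    obtain ⟨n, -, -, rfl⟩ := ((G.rot_sameCycle_iff _ _).2 h).exists_pow_eq''
    clear h
    induction n with
    | zero => exact hd
    | succ n ih =>
      rw [pow_succ', Equiv.Perm.mul_apply]
      have := isSpecialDart_next hface hval hv (isSpecialDart_opp.2 ih)
      rwa [next_apply, G.opp_opp] at this
  -- The property is carried by darts, not vertices, because a chain of sites may pass through
  -- boundary circles.
  have key : ∀ s, ∃ d, G.site d = s ∧ G.IsSpecialDart d := by
    intro s
    induction G.connected (Sum.inl v₀) s with
    | refl =>
      obtain ⟨d, hd⟩ := card_pos.1 (two_pos.trans_le h₀)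
      rw [mem_boundaryDarts] at hd
      exact ⟨d, hd.1, v₀, h₀, .inl hd.1⟩
    | tail _ h ih =>
      obtain ⟨w, w', hw, hw', h⟩ := h
      obtain ⟨d₀, hd₀, hs₀⟩ := ih
      have hf := (hface (G.face w)).1
      obtain rfl := hf.unique rfl h.symm
      obtain ⟨d₁, rfl⟩ := exists_walkOf_of_disk hf rfl
      obtain ⟨d₂, h₂, hd₂⟩ := (G.touches_walkOf_iff _ _).1 hw
      obtain ⟨d₃, h₃, hd₃⟩ := (G.touches_walkOf_iff _ _).1 hw'
      exact ⟨d₃, hd₃, hnext d₂ d₃ (h₂.symm.trans h₃) (hrot d₀ d₂ (hd₀.trans hd₂.symm) hs₀)⟩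
  obtain ⟨d, hd, u, hu, h | h⟩ := key (Sum.inl v)
  · rwa [Sum.inl_injective (hd.symm.trans h)]
  · exact two_le_card_boundaryDarts_of_edge hface hval hv hu h (by rw [G.opp_opp, hd])

theorem vertexExcess_nonneg {v : V} (h0 : #(G.boundaryDarts v) = 0 → 6 ≤ #(G.darts v))
    (h1 : #(G.boundaryDarts v) = 1 → 5 ≤ #(G.darts v)) : 0 ≤ G.vertexExcess v := by
  have := G.two_mul_card_boundaryDarts_le v
  unfold vertexExcess
  omega

end AnnularGraph

/-! ### The proposition. -/

open AnnularGraph RibbonData in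
theorem proposition3p1 {V D F : Type*} [Finite V] [Finite D] [Fintype F]
    (G : AnnularGraph V D F) (hG : G.IsReduced) :
    (∃ v, G.IsInteriorVertex v ∧ G.valency v ≤ 5) ∨
    (∃ v, G.IsBoundaryVertex v ∧ G.valency v ≤ 4 ∧ (G.boundaryEdgesAt v).ncard = 1) ∨
    G.IsTriangular ∨
    G.IsSpecial := by
  have : Fintype D := Fintype.ofFinite D
  have : Fintype V := Fintype.ofFinite V
  simp only [IsInteriorVertex, isBoundaryVertex_iff, valency_eq_card_darts, ncard_boundaryEdgesAt]
  by_contra! h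
  obtain ⟨h0, h1, h3, h4⟩ := h
  have h0 : ∀ v, #(G.boundaryDarts v) = 0 → 6 ≤ #(G.darts v) := fun v hv => h0 v hv.le
  have h1 : ∀ v, #(G.boundaryDarts v) = 1 → 5 ≤ #(G.darts v) := by
    intro v hv
    by_contra! hlt
    exact h1 v (by omega) (by omega) hv
  obtain ⟨w, hw⟩ := not_forall.1 (mt hG.isSpecial h4)
  have : Nonempty V := ⟨w⟩
  have hvn : ∀ v ∈ univ, 0 ≤ G.vertexExcess v := fun v _ => vertexExcess_nonneg (h0 v) (h1 v)
  have hfn : ∀ f ∈ univ, 0 ≤ G.faceExcess f := fun f _ => hG.faceExcess_nonneg f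
  have hsum := G.sum_excess
  have hvz : ∀ v, G.vertexExcess v = 0 := fun v =>
    (sum_eq_zero_iff_of_nonneg hvn).1 (by linarith [sum_nonneg hvn, sum_nonneg hfn]) v (mem_univ v)
  have hfz : ∀ f, G.faceExcess f = 0 := fun f =>
    (sum_eq_zero_iff_of_nonneg hfn).1 (by linarith [sum_nonneg hvn, sum_nonneg hfn]) f (mem_univ f)
  have hface := fun f => hG.of_faceExcess_eq_zero (hfz f)
  have hle : ∀ v, #(G.boundaryDarts v) ≤ 1 := by
    intro v
    by_contra! hv
    refine hw (forall_two_le_card_boundaryDarts hface ?_ ?_ hv w)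
    · intro v hv
      have := h0 v
      have := h1 v
      omega
    · intro v hv
      -- Excess 0 and 2b ≤ n + c give 3b ≤ 6, so b = 2 and n + c = 4.
      have := hvz v
      have := G.two_mul_card_boundaryDarts_le v
      unfold vertexExcess at *
      omega
  -- For b ≤ 1 already n + b ≥ 6, which leaves no room for corners.
  have hcorner : ∀ v, #(G.cornersAt v) = 0 := by
    intro v
    have := hvz v
    have := h0 v
    have := h1 v
    have := hle v
    unfold vertexExcess at *
    omega
  have hcorner' : ∀ f ∈ univ, #(G.cornersIn f) = 0 := by
    rw [← sum_eq_zero_iff, G.sum_card_cornersIn]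
    exact sum_eq_zero fun v _ => hcorner v
  refine h3 ⟨fun v => ?_, fun v hv => ?_, fun v hv => ?_, fun f => ?_⟩
  · rw [ncard_boundaryEdgesAt]
    exact hle v
  · rw [IsInteriorVertex, isBoundaryVertex_iff] at hv
    have := hvz v
    have := hcorner v
    rw [valency_eq_card_darts]
    unfold vertexExcess at *
    omega
  · rw [isBoundaryVertex_iff] at hv
    have := hvz v
    have := hcorner v
    have := hle v
    rw [valency_eq_card_darts]
    unfold vertexExcess at *
    omega
  · have := hcorner' f (mem_univ f)
    exact isPolygon_iff.2 ⟨(hface f).1, by have := (hface f).2; omega⟩
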